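/- Let $B=M_2(\mathbb{C})$ and $A=\mathbb{C}^2\cong\mathrm{C}^*(\mathbb{Z}_2)$. Let $C$ be a unital $\mathrm{C}^*$-algebra and $\Phi\colon A\to B\otimes C$ a unital $*$-homomorphism such that $(C,\Phi)$ is the quantum space of all maps from the quantum space of $B$ to the quantum space of $A$. That is, for every unital $\mathrm{C}^*$-algebra $D$ and every unital $*$-homomorphism $\Psi\colon A\to B\otimes D$ there is a unique unital $*$-homomorphism $\Lambda\colon C\to D$ with $(\mathrm{id}_B\otimes\Lambda)\circ\Phi=\Psi$. (This property determines $(C,\Phi)$ up to isomorphism.) Then $C$ does not admit a compact quantum group structure. In other words, there is no unital $*$-homomorphism $\Delta\colon C\to C\otimes C$ (minimal $\mathrm{C}^*$-tensor product) such that $(\Delta\otimes\mathrm{id})\circ\Delta=(\mathrm{id}\otimes\Delta)\circ\Delta$ and such that the linear spans of $\{(a\otimes 1)\Delta(b) : a,b\in C\}$ and of $\{(1\otimes a)\Delta(b) : a,b\in C\}$ are both dense in $C\otimes C$. -/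

import Mathlib

open scoped TensorProduct

universe u

set_option linter.unusedSectionVars false

noncomputable section

/-- A C*-seminorm on a unital complex `*`-algebra. -/
structure CStarSeminorm (R : Type*) [Ring R] [StarRing R] [Algebra ℂ R] extends
    RingSeminorm R where
  smul' : ∀ (c : ℂ) (x : R), toFun (c • x) = ‖c‖ * toFun x
  star_mul_self' : ∀ x : R, toFun x * toFun x ≤ toFun (star x * x)

theorem starAlgHom_continuous {A D : Type*} [CStarAlgebra A] [CStarAlgebra D]
    (f : A →⋆ₐ[ℂ] D) : Continuous f :=
  AddMonoidHomClass.continuous_of_bound f 1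
    (fun x => by simpa using NonUnitalStarAlgHom.norm_apply_le f x)

namespace CStarSeminorm

variable {R : Type*} [Ring R] [StarRing R] [Algebra ℂ R] [StarModule ℂ R]

instance : CoeFun (CStarSeminorm R) (fun _ => R → ℝ) := ⟨fun p => p.toFun⟩

/-- The `*`-algebra `R`, to be topologised by the seminorm `p`. -/
def Pre (_p : CStarSeminorm R) : Type _ := R

variable (p : CStarSeminorm R)

instance : SeminormedRing p.Pre := p.toRingSeminorm.toSeminormedRing
instance : StarRing p.Pre := inferInstanceAs (StarRing R)
instance : Algebra ℂ p.Pre := inferInstanceAs (Algebra ℂ R)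
instance : StarModule ℂ p.Pre := inferInstanceAs (StarModule ℂ R)

theorem norm_pre_def (x : p.Pre) : ‖x‖ = p x := rfl

theorem nonneg (x : R) : 0 ≤ p x := norm_nonneg (E := p.Pre) x

instance : NormedSpace ℂ p.Pre where
  norm_smul_le c x := (p.smul' c x).le

instance : NormedAlgebra ℂ p.Pre where
  norm_smul_le c x := (p.smul' c x).le

theorem le_star (x : R) : p x ≤ p (star x) := by
  rcases (p.nonneg x).eq_or_lt with h | h
  · rw [← h]; exact p.nonneg _
  · exact le_of_mul_le_mul_right ((p.star_mul_self' x).trans (p.mul_le' _ _)) h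

theorem star_le (x : R) : p (star x) ≤ p x := by
  simpa only [star_star] using p.le_star (star x)

instance : NormedStarGroup p.Pre where
  norm_star_le x := by
    exact p.star_le x

/-- The C*-algebra obtained from `R` by separation and completion with respect to `p`. -/
def Compl : Type _ := UniformSpace.Completion p.Pre

instance : NormedRing p.Compl := inferInstanceAs (NormedRing (UniformSpace.Completion p.Pre))
instance : CompleteSpace p.Compl := inferInstanceAs (CompleteSpace (UniformSpace.Completion p.Pre))
instance : Algebra ℂ p.Compl := inferInstanceAs (Algebra ℂ (UniformSpace.Completion p.Pre))

instance : NormedAlgebra ℂ p.Compl where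
  norm_smul_le c x := norm_smul_le (β := UniformSpace.Completion p.Pre) c x

/-- The canonical map of `R` to its completion. -/
def toComplRingHom : R →+* p.Compl :=
  (UniformSpace.Completion.coeRingHom : p.Pre →+* UniformSpace.Completion p.Pre)

theorem norm_toComplRingHom (x : R) : ‖p.toComplRingHom x‖ = p x :=
  UniformSpace.Completion.norm_coe (E := p.Pre) x

theorem denseRange_toComplRingHom : DenseRange p.toComplRingHom :=
  UniformSpace.Completion.denseRange_coe (α := p.Pre)

theorem isometry_star_pre : Isometry (star : p.Pre → p.Pre) := star_isometry

instance : Star p.Compl where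
  star := UniformSpace.Completion.map (star : p.Pre → p.Pre)

theorem continuous_star_compl : Continuous (star : p.Compl → p.Compl) :=
  UniformSpace.Completion.continuous_map

theorem star_toComplRingHom (x : R) : star (p.toComplRingHom x) = p.toComplRingHom (star x) :=
  UniformSpace.Completion.map_coe p.isometry_star_pre.uniformContinuous x

theorem smul_toComplRingHom (c : ℂ) (x : R) :
    c • p.toComplRingHom x = p.toComplRingHom (c • x) :=
  (UniformSpace.Completion.coe_smul (X := p.Pre) c x).symm

instance : StarRing p.Compl where
  star_involutive x := by
    refine p.denseRange_toComplRingHom.induction_on x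
      (isClosed_eq (p.continuous_star_compl.comp p.continuous_star_compl) continuous_id) fun a => ?_
    simp [star_toComplRingHom]
  star_mul x y := by
    refine p.denseRange_toComplRingHom.induction_on₂
      (p := fun x y : p.Compl => star (x * y) = star y * star x) ?_ ?_ x y
    · exact isClosed_eq (p.continuous_star_compl.comp continuous_mul)
        ((p.continuous_star_compl.comp continuous_snd).mul
          (p.continuous_star_compl.comp continuous_fst))
    · intro a b
      simp only [star_toComplRingHom, ← map_mul, star_mul]
  star_add x y := by
    refine p.denseRange_toComplRingHom.induction_on₂
      (p := fun x y : p.Compl => star (x + y) = star x + star y) ?_ ?_ x y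
    · exact isClosed_eq (p.continuous_star_compl.comp continuous_add)
        ((p.continuous_star_compl.comp continuous_fst).add
          (p.continuous_star_compl.comp continuous_snd))
    · intro a b
      simp only [star_toComplRingHom, ← map_add, star_add]

instance : CStarAlgebra p.Compl where
  norm_mul_self_le x := by
    refine p.denseRange_toComplRingHom.induction_on x
      (isClosed_le (continuous_norm.mul continuous_norm)
        (continuous_norm.comp (p.continuous_star_compl.mul continuous_id))) fun a => ?_
    change _ ≤ ‖star (p.toComplRingHom a) * p.toComplRingHom a‖
    rw [star_toComplRingHom, ← map_mul, norm_toComplRingHom, norm_toComplRingHom]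
    exact p.star_mul_self' a
  star_smul c x := by
    refine p.denseRange_toComplRingHom.induction_on x
      (isClosed_eq (p.continuous_star_compl.comp (continuous_const_smul c))
        ((continuous_const_smul (star c)).comp p.continuous_star_compl)) fun a => ?_
    rw [smul_toComplRingHom, star_toComplRingHom, star_smul, star_toComplRingHom,
      smul_toComplRingHom]

/-- The canonical `*`-homomorphism of `R` to its completion. -/
def toCompl : R →⋆ₐ[ℂ] p.Compl where
  __ := p.toComplRingHom
  commutes' c := by
    have := p.smul_toComplRingHom c 1
    simp only [map_one] at this
    rw [Algebra.algebraMap_eq_smul_one, Algebra.algebraMap_eq_smul_one]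
    exact this.symm
  map_star' x := (p.star_toComplRingHom x).symm

theorem norm_toCompl (x : R) : ‖p.toCompl x‖ = p x := p.norm_toComplRingHom x

theorem denseRange_toCompl : DenseRange p.toCompl := p.denseRange_toComplRingHom

variable {D : Type*} [CStarAlgebra D]

theorem starAlgHom_ext {f g : p.Compl →⋆ₐ[ℂ] D}
    (h : ∀ x, f (p.toCompl x) = g (p.toCompl x)) : f = g := by
  apply DFunLike.coe_injective
  exact p.denseRange_toCompl.equalizer (starAlgHom_continuous f) (starAlgHom_continuous g)
    (funext h)

/-- A `*`-homomorphism on `R`, regarded as a ring homomorphism on the topologised copy of `R`. -/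
def preHom (f : R →⋆ₐ[ℂ] D) : p.Pre →+* D := (f : R →+* D)

theorem continuous_preHom (f : R →⋆ₐ[ℂ] D) (hf : ∀ x, ‖f x‖ ≤ p x) : Continuous (p.preHom f) :=
  AddMonoidHomClass.continuous_of_bound (p.preHom f) 1 (fun x => by rw [one_mul]; exact hf x)

/-- A `*`-homomorphism dominated by `p` extends to the completion. -/
def lift (f : R →⋆ₐ[ℂ] D) (hf : ∀ x, ‖f x‖ ≤ p x) : p.Compl →⋆ₐ[ℂ] D :=
  let F : p.Compl →+* D :=
    UniformSpace.Completion.extensionHom (p.preHom f) (p.continuous_preHom f hf)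
  have hF : ∀ x : R, F (p.toCompl x) = f x := fun x =>
    UniformSpace.Completion.extensionHom_coe (p.preHom f) (p.continuous_preHom f hf) x
  have hFc : Continuous F := UniformSpace.Completion.continuous_extension
  { F with
    commutes' := fun c => by
      have h : algebraMap ℂ p.Compl c = p.toCompl (algebraMap ℂ R c) :=
        (AlgHomClass.commutes p.toCompl c).symm
      change F _ = _
      rw [h, hF]
      exact AlgHomClass.commutes f c
    map_star' := fun x => by
      change F _ = star (F _)
      refine p.denseRange_toCompl.induction_on x
        (isClosed_eq (hFc.comp p.continuous_star_compl) (continuous_star.comp hFc)) fun a => ?_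
      rw [← map_star, hF, hF, map_star] }

@[simp]
theorem lift_toCompl (f : R →⋆ₐ[ℂ] D) (hf : ∀ x, ‖f x‖ ≤ p x) (x : R) :
    p.lift f hf (p.toCompl x) = f x :=
  UniformSpace.Completion.extensionHom_coe (p.preHom f) (p.continuous_preHom f hf) x

end CStarSeminorm

section Supremum

variable {R : Type*} [Ring R] [StarRing R] [Algebra ℂ R] [StarModule ℂ R]

/-- The supremum `x ↦ sup_i ‖f_i x‖` over a pointwise bounded family of `*`-homomorphisms into
C*-algebras. -/
def CStarSeminorm.ofFamily {ι : Type*} {D : ι → Type*} [∀ i, CStarAlgebra (D i)]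
    (f : ∀ i, R →⋆ₐ[ℂ] D i) (hb : ∀ x, BddAbove (Set.range fun i => ‖f i x‖)) :
    CStarSeminorm R where
  toFun x := ⨆ i, ‖f i x‖
  map_zero' := by simp
  add_le' x y := by
    refine Real.iSup_le (fun i => ?_) (add_nonneg
      (Real.iSup_nonneg fun i => norm_nonneg _) (Real.iSup_nonneg fun i => norm_nonneg _))
    rw [map_add]
    exact (norm_add_le _ _).trans (add_le_add (le_ciSup (hb x) i) (le_ciSup (hb y) i))
  neg' x := by simp
  mul_le' x y := by
    refine Real.iSup_le (fun i => ?_) (mul_nonneg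
      (Real.iSup_nonneg fun i => norm_nonneg _) (Real.iSup_nonneg fun i => norm_nonneg _))
    rw [map_mul]
    exact (norm_mul_le _ _).trans (mul_le_mul (le_ciSup (hb x) i) (le_ciSup (hb y) i)
      (norm_nonneg _) (Real.iSup_nonneg fun i => norm_nonneg _))
  smul' c x := by
    simp only [map_smul, norm_smul]
    exact (Real.mul_iSup_of_nonneg (norm_nonneg c) _).symm
  star_mul_self' x := by
    have h0 : (0 : ℝ) ≤ ⨆ i, ‖f i (star x * x)‖ := Real.iSup_nonneg fun i => norm_nonneg _
    have h : ⨆ i, ‖f i x‖ ≤ √(⨆ i, ‖f i (star x * x)‖) := by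
      refine Real.iSup_le (fun i => ?_) (Real.sqrt_nonneg _)
      refine Real.le_sqrt_of_sq_le ?_
      rw [sq, ← CStarRing.norm_star_mul_self, ← map_star, ← map_mul]
      exact le_ciSup (hb (star x * x)) i
    calc _ ≤ √(⨆ i, ‖f i (star x * x)‖) * √(⨆ i, ‖f i (star x * x)‖) :=
          mul_self_le_mul_self (Real.iSup_nonneg fun i => norm_nonneg _) h
      _ = _ := Real.mul_self_sqrt h0

theorem CStarSeminorm.le_ofFamily {ι : Type*} {D : ι → Type*} [∀ i, CStarAlgebra (D i)]
    (f : ∀ i, R →⋆ₐ[ℂ] D i) (hb : ∀ x, BddAbove (Set.range fun i => ‖f i x‖)) (i : ι) (x : R) :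
    ‖f i x‖ ≤ CStarSeminorm.ofFamily f hb x :=
  le_ciSup (hb x) i

theorem CStarSeminorm.ofFamily_le {ι : Type*} {D : ι → Type*} [∀ i, CStarAlgebra (D i)]
    (f : ∀ i, R →⋆ₐ[ℂ] D i) (hb : ∀ x, BddAbove (Set.range fun i => ‖f i x‖)) (x : R) {M : ℝ}
    (hM : 0 ≤ M) (h : ∀ i, ‖f i x‖ ≤ M) : CStarSeminorm.ofFamily f hb x ≤ M :=
  Real.iSup_le h hM

end Supremum

section AlgebraicTensor

variable {A B D : Type*} [Ring A] [StarRing A] [Algebra ℂ A] [StarModule ℂ A]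
  [Ring B] [StarRing B] [Algebra ℂ B] [StarModule ℂ B]
  [Ring D] [StarRing D] [Algebra ℂ D] [StarModule ℂ D]

/-- Two `*`-homomorphisms with commuting ranges define `a ⊗ b ↦ f a * g b` on the algebraic tensor
product. -/
def starTensorLift (f : A →⋆ₐ[ℂ] D) (g : B →⋆ₐ[ℂ] D) (h : ∀ a b, Commute (f a) (g b)) :
    A ⊗[ℂ] B →⋆ₐ[ℂ] D where
  __ := Algebra.TensorProduct.lift (f : A →ₐ[ℂ] D) (g : B →ₐ[ℂ] D) h
  map_star' x := by
    induction x using TensorProduct.induction_on with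
    | zero => simp
    | tmul a b =>
      change f (star a) * g (star b) = star (f a * g b)
      rw [star_mul, map_star, map_star, ← map_star f, ← map_star g]
      exact h _ _
    | add x y hx hy =>
      simp only [star_add, AlgHom.toRingHom_eq_coe, RingHom.toMonoidHom_eq_coe,
        OneHom.toFun_eq_coe, MonoidHom.toOneHom_coe, MonoidHom.coe_coe, RingHom.coe_coe,
        map_add] at hx hy ⊢
      rw [hx, hy]

@[simp]
theorem starTensorLift_tmul (f : A →⋆ₐ[ℂ] D) (g : B →⋆ₐ[ℂ] D)
    (h : ∀ a b, Commute (f a) (g b)) (a : A) (b : B) :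
    starTensorLift f g h (a ⊗ₜ b) = f a * g b := rfl

theorem starTensor_ext {f g : A ⊗[ℂ] B →⋆ₐ[ℂ] D} (h : ∀ a b, f (a ⊗ₜ b) = g (a ⊗ₜ b)) : f = g := by
  ext x
  induction x using TensorProduct.induction_on with
  | zero => simp
  | tmul a b => exact h a b
  | add x y hx hy => rw [map_add, map_add, hx, hy]

variable (A B) in
/-- The embedding `a ↦ a ⊗ 1`. -/
def starInclLeft : A →⋆ₐ[ℂ] A ⊗[ℂ] B where
  __ := (Algebra.TensorProduct.includeLeft : A →ₐ[ℂ] A ⊗[ℂ] B)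
  map_star' a := by
    change star a ⊗ₜ[ℂ] (1 : B) = star (a ⊗ₜ[ℂ] (1 : B))
    simp

variable (A B) in
/-- The embedding `b ↦ 1 ⊗ b`. -/
def starInclRight : B →⋆ₐ[ℂ] A ⊗[ℂ] B where
  __ := (Algebra.TensorProduct.includeRight : B →ₐ[ℂ] A ⊗[ℂ] B)
  map_star' b := by
    change (1 : A) ⊗ₜ[ℂ] star b = star ((1 : A) ⊗ₜ[ℂ] b)
    simp

@[simp] theorem starInclLeft_apply (a : A) : starInclLeft A B a = a ⊗ₜ 1 := rfl
@[simp] theorem starInclRight_apply (b : B) : starInclRight A B b = 1 ⊗ₜ b := rfl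

end AlgebraicTensor

section Bounds

universe v w

/-- All `*`-homomorphisms from an algebraic tensor product of C*-algebras into C*-algebras are
bounded at each point by one constant. -/
theorem exists_bound_tensor {A B : Type*} [CStarAlgebra A] [CStarAlgebra B] (x : A ⊗[ℂ] B) :
    ∃ M : ℝ, ∀ (D : Type v) [CStarAlgebra D] (f : A ⊗[ℂ] B →⋆ₐ[ℂ] D), ‖f x‖ ≤ M := by
  induction x using TensorProduct.induction_on with
  | zero => exact ⟨0, fun D _ f => by simp⟩
  | tmul a b =>
    refine ⟨‖a‖ * ‖b‖, fun D _ f => ?_⟩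
    have h : f (a ⊗ₜ b) = f.comp (starInclLeft A B) a * f.comp (starInclRight A B) b := by
      simp [← map_mul]
    rw [h]
    exact (norm_mul_le _ _).trans (mul_le_mul (NonUnitalStarAlgHom.norm_apply_le _ a)
      (NonUnitalStarAlgHom.norm_apply_le _ b) (norm_nonneg _) (norm_nonneg _))
  | add x y hx hy =>
    obtain ⟨M, hM⟩ := hx
    obtain ⟨N, hN⟩ := hy
    refine ⟨M + N, fun D _ f => ?_⟩
    rw [map_add]
    exact (norm_add_le _ _).trans (add_le_add (hM D f) (hN D f))

theorem exists_bound_tensor₃ {A B C : Type*} [CStarAlgebra A] [CStarAlgebra B] [CStarAlgebra C]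
    (x : A ⊗[ℂ] (B ⊗[ℂ] C)) :
    ∃ M : ℝ, ∀ (D : Type v) [CStarAlgebra D] (f : A ⊗[ℂ] (B ⊗[ℂ] C) →⋆ₐ[ℂ] D), ‖f x‖ ≤ M := by
  induction x using TensorProduct.induction_on with
  | zero => exact ⟨0, fun D _ f => by simp⟩
  | tmul a y =>
    obtain ⟨M, hM⟩ := exists_bound_tensor.{v} y
    refine ⟨‖a‖ * M, fun D _ f => ?_⟩
    have h : f (a ⊗ₜ y) = f.comp (starInclLeft A _) a * f.comp (starInclRight A _) y := by
      simp [← map_mul]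
    rw [h]
    exact (norm_mul_le _ _).trans (mul_le_mul (NonUnitalStarAlgHom.norm_apply_le _ a)
      (hM D _) (norm_nonneg _) (norm_nonneg _))
  | add x y hx hy =>
    obtain ⟨M, hM⟩ := hx
    obtain ⟨N, hN⟩ := hy
    refine ⟨M + N, fun D _ f => ?_⟩
    rw [map_add]
    exact (norm_add_le _ _).trans (add_le_add (hM D f) (hN D f))

end Bounds

section Hilbert

open UniformSpace

variable (H K L : Type*) [NormedAddCommGroup H] [InnerProductSpace ℂ H] [CompleteSpace H]
  [NormedAddCommGroup K] [InnerProductSpace ℂ K] [CompleteSpace K]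
  [NormedAddCommGroup L] [InnerProductSpace ℂ L] [CompleteSpace L]

/-- The Hilbert space tensor product: the completion of the algebraic tensor product for the inner
product determined by `⟪x ⊗ y, x' ⊗ y'⟫ = ⟪x, x'⟫ * ⟪y, y'⟫`. -/
def HilbertTensor : Type _ := Completion (H ⊗[ℂ] K)

instance : NormedAddCommGroup (HilbertTensor H K) :=
  inferInstanceAs (NormedAddCommGroup (Completion (H ⊗[ℂ] K)))

instance : InnerProductSpace ℂ (HilbertTensor H K) :=
  inferInstanceAs (InnerProductSpace ℂ (Completion (H ⊗[ℂ] K)))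

instance : CompleteSpace (HilbertTensor H K) :=
  inferInstanceAs (CompleteSpace (Completion (H ⊗[ℂ] K)))

/-- The inclusion of the algebraic tensor product in the Hilbert space tensor product. -/
def HilbertTensor.incl : H ⊗[ℂ] K →ₗᵢ[ℂ] HilbertTensor H K :=
  (Completion.toComplₗᵢ : H ⊗[ℂ] K →ₗᵢ[ℂ] Completion (H ⊗[ℂ] K))

theorem HilbertTensor.denseRange_incl : DenseRange (HilbertTensor.incl H K) :=
  Completion.denseRange_coe (α := H ⊗[ℂ] K)

variable {H K} in
/-- The elementary tensor `x ⊗ y`. -/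
def htmul (x : H) (y : K) : HilbertTensor H K := HilbertTensor.incl H K (x ⊗ₜ y)

variable {H K} in
theorem hilbertTensor_ext {E : Type*} [NormedAddCommGroup E] [NormedSpace ℂ E]
    {S T : HilbertTensor H K →L[ℂ] E} (h : ∀ x y, S (htmul x y) = T (htmul x y)) : S = T := by
  ext z
  refine (HilbertTensor.denseRange_incl H K).induction_on z
    (isClosed_eq S.continuous T.continuous) fun z => ?_
  induction z using TensorProduct.induction_on with
  | zero => simp
  | tmul x y => exact h x y
  | add x y hx hy => rw [map_add, map_add, map_add, hx, hy]

variable {H K} in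
/-- The extension of a bounded operator on the algebraic tensor product. -/
def HilbertTensor.extend (T : H ⊗[ℂ] K →L[ℂ] H ⊗[ℂ] K) :
    HilbertTensor H K →L[ℂ] HilbertTensor H K :=
  (T.completion : Completion (H ⊗[ℂ] K) →L[ℂ] Completion (H ⊗[ℂ] K))

variable {H K} in
@[simp]
theorem HilbertTensor.extend_incl (T : H ⊗[ℂ] K →L[ℂ] H ⊗[ℂ] K) (z : H ⊗[ℂ] K) :
    HilbertTensor.extend T (HilbertTensor.incl H K z) = HilbertTensor.incl H K (T z) :=
  ContinuousLinearMap.completion_apply_coe T z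

/-- The amplification `T ↦ T ⊗ 1`. -/
def ampLeft : (H →L[ℂ] H) →⋆ₐ[ℂ] (HilbertTensor H K →L[ℂ] HilbertTensor H K) where
  toFun T := HilbertTensor.extend (T.rTensor K)
  map_one' := hilbertTensor_ext fun x y => by simp [htmul]
  map_mul' S T := hilbertTensor_ext fun x y => by simp [htmul]
  map_zero' := hilbertTensor_ext fun x y => by simp [htmul]
  map_add' S T := hilbertTensor_ext fun x y => by simp [htmul]
  commutes' c := hilbertTensor_ext fun x y => by
    simp [htmul, Algebra.algebraMap_eq_smul_one, ← map_smul, TensorProduct.smul_tmul']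
  map_star' T := by
    refine (ContinuousLinearMap.eq_adjoint_iff _ _).mpr fun x y => ?_
    refine (HilbertTensor.denseRange_incl H K).induction_on₂ (p := fun x y =>
      inner ℂ (HilbertTensor.extend ((star T).rTensor K) x) y =
        inner ℂ x (HilbertTensor.extend (T.rTensor K) y))
      (by apply isClosed_eq <;> fun_prop) (fun x y => ?_) x y
    simp only [HilbertTensor.extend_incl, LinearIsometry.inner_map_map]
    induction x using TensorProduct.induction_on with
    | zero => simp
    | add a b ha hb => simp only [map_add, inner_add_left, ha, hb]
    | tmul a b =>
      induction y using TensorProduct.induction_on with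
      | zero => simp
      | add a b ha hb => simp only [map_add, inner_add_right, ha, hb]
      | tmul c d =>
        simp [ContinuousLinearMap.star_eq_adjoint, ContinuousLinearMap.adjoint_inner_left]

/-- The amplification `T ↦ 1 ⊗ T`. -/
def ampRight : (K →L[ℂ] K) →⋆ₐ[ℂ] (HilbertTensor H K →L[ℂ] HilbertTensor H K) where
  toFun T := HilbertTensor.extend (T.lTensor H)
  map_one' := hilbertTensor_ext fun x y => by simp [htmul]
  map_mul' S T := hilbertTensor_ext fun x y => by simp [htmul]
  map_zero' := hilbertTensor_ext fun x y => by simp [htmul]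
  map_add' S T := hilbertTensor_ext fun x y => by simp [htmul]
  commutes' c := hilbertTensor_ext fun x y => by
    simp [htmul, Algebra.algebraMap_eq_smul_one, ← map_smul, TensorProduct.smul_tmul']
  map_star' T := by
    refine (ContinuousLinearMap.eq_adjoint_iff _ _).mpr fun x y => ?_
    refine (HilbertTensor.denseRange_incl H K).induction_on₂ (p := fun x y =>
      inner ℂ (HilbertTensor.extend ((star T).lTensor H) x) y =
        inner ℂ x (HilbertTensor.extend (T.lTensor H) y))
      (by apply isClosed_eq <;> fun_prop) (fun x y => ?_) x y
    simp only [HilbertTensor.extend_incl, LinearIsometry.inner_map_map]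
    induction x using TensorProduct.induction_on with
    | zero => simp
    | add a b ha hb => simp only [map_add, inner_add_left, ha, hb]
    | tmul a b =>
      induction y using TensorProduct.induction_on with
      | zero => simp
      | add a b ha hb => simp only [map_add, inner_add_right, ha, hb]
      | tmul c d =>
        simp [ContinuousLinearMap.star_eq_adjoint, ContinuousLinearMap.adjoint_inner_left]

variable {H K} in
@[simp]
theorem ampLeft_htmul (T : H →L[ℂ] H) (x : H) (y : K) :
    ampLeft H K T (htmul x y) = htmul (T x) y := by
  simp [ampLeft, htmul]

variable {H K} in
@[simp]
theorem ampRight_htmul (T : K →L[ℂ] K) (x : H) (y : K) :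
    ampRight H K T (htmul x y) = htmul x (T y) := by
  simp [ampRight, htmul]

variable {H K} in
theorem commute_amp (S : H →L[ℂ] H) (T : K →L[ℂ] K) :
    Commute (ampLeft H K S) (ampRight H K T) :=
  hilbertTensor_ext fun x y => by simp


end Hilbert

section Hilbert

open UniformSpace

variable (H K L : Type*) [NormedAddCommGroup H] [InnerProductSpace ℂ H] [CompleteSpace H]
  [NormedAddCommGroup K] [InnerProductSpace ℂ K] [CompleteSpace K]
  [NormedAddCommGroup L] [InnerProductSpace ℂ L] [CompleteSpace L]

/-- The isometry of the algebraic tensor product into `(H ⊗ K) ⊗ L`. -/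
def assocSource : (H ⊗[ℂ] K) ⊗[ℂ] L →ₗᵢ[ℂ] HilbertTensor (HilbertTensor H K) L :=
  (HilbertTensor.incl (HilbertTensor H K) L).comp ((HilbertTensor.incl H K).rTensor L)

/-- The isometry of the algebraic tensor product into `H ⊗ (K ⊗ L)`. -/
def assocTarget : H ⊗[ℂ] (K ⊗[ℂ] L) →ₗᵢ[ℂ] HilbertTensor H (HilbertTensor K L) :=
  (HilbertTensor.incl H (HilbertTensor K L)).comp ((HilbertTensor.incl K L).lTensor H)

theorem denseRange_assocSource :
    DenseRange (assocSource H K L) := by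
  refine (HilbertTensor.denseRange_incl (HilbertTensor H K) L).comp ?_
    (HilbertTensor.incl (HilbertTensor H K) L).continuous
  intro z
  induction z using TensorProduct.induction_on with
  | zero => exact subset_closure ⟨0, by simp⟩
  | tmul w l =>
    have hc : Continuous fun w : HilbertTensor H K => w ⊗ₜ[ℂ] l :=
      TensorProduct.continuous_tmul.comp (continuous_id.prodMk continuous_const)
    have := HilbertTensor.denseRange_incl H K w
    refine closure_mono ?_ (image_closure_subset_closure_image hc ⟨w, this, rfl⟩)
    rintro _ ⟨_, ⟨v, rfl⟩, rfl⟩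
    exact ⟨v ⊗ₜ l, by simp⟩
  | add x y hx hy =>
    exact (Submodule.topologicalClosure (LinearMap.range
      ((HilbertTensor.incl H K).rTensor L).toLinearMap)).add_mem
        hx hy

theorem denseRange_assocTarget :
    DenseRange (assocTarget H K L) := by
  refine (HilbertTensor.denseRange_incl H (HilbertTensor K L)).comp ?_
    (HilbertTensor.incl H (HilbertTensor K L)).continuous
  intro z
  induction z using TensorProduct.induction_on with
  | zero => exact subset_closure ⟨0, by simp⟩
  | tmul h w =>
    have hc : Continuous fun w : HilbertTensor K L => h ⊗ₜ[ℂ] w :=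
      TensorProduct.continuous_tmul.comp (continuous_const.prodMk continuous_id)
    have := HilbertTensor.denseRange_incl K L w
    refine closure_mono ?_ (image_closure_subset_closure_image hc ⟨w, this, rfl⟩)
    rintro _ ⟨_, ⟨v, rfl⟩, rfl⟩
    exact ⟨h ⊗ₜ v, by simp⟩
  | add x y hx hy =>
    exact (Submodule.topologicalClosure (LinearMap.range
      ((HilbertTensor.incl K L).lTensor H).toLinearMap)).add_mem
        hx hy

/-- The associativity unitary `(H ⊗ K) ⊗ L → H ⊗ (K ⊗ L)`. -/
def hilbertAssoc : HilbertTensor (HilbertTensor H K) L ≃ₗᵢ[ℂ] HilbertTensor H (HilbertTensor K L) :=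
  (TensorProduct.assoc ℂ H K L).extendOfIsometry
    (assocSource H K L).toLinearMap (assocTarget H K L).toLinearMap (denseRange_assocSource H K L)
    (denseRange_assocTarget H K L) (fun x => by
      rw [LinearIsometry.coe_toLinearMap, LinearIsometry.coe_toLinearMap, LinearIsometry.norm_map,
        LinearIsometry.norm_map, TensorProduct.norm_assoc])

variable {H K L}

@[simp]
theorem hilbertAssoc_htmul (x : H) (y : K) (z : L) :
    hilbertAssoc H K L (htmul (htmul x y) z) = htmul x (htmul y z) :=
  (TensorProduct.assoc ℂ H K L).extendOfIsometry_eq _ _ (denseRange_assocSource H K L)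
    (denseRange_assocTarget H K L) _ ((x ⊗ₜ y) ⊗ₜ z)

@[simp]
theorem hilbertAssoc_symm_htmul (x : H) (y : K) (z : L) :
    (hilbertAssoc H K L).symm (htmul x (htmul y z)) = htmul (htmul x y) z := by
  rw [LinearIsometryEquiv.symm_apply_eq, hilbertAssoc_htmul]

/-- `y ↦ x ⊗ y` -/
def htmulL (x : H) : K →L[ℂ] HilbertTensor H K :=
  (HilbertTensor.incl H K).toContinuousLinearMap.comp (TensorProduct.mkL ℂ H K x)

theorem htmulL_apply (x : H) (y : K) : htmulL x y = htmul x y := rfl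

theorem hilbertTensor_ext₃ {E : Type*} [NormedAddCommGroup E] [NormedSpace ℂ E]
    {S T : HilbertTensor H (HilbertTensor K L) →L[ℂ] E}
    (h : ∀ x y z, S (htmul x (htmul y z)) = T (htmul x (htmul y z))) : S = T :=
  hilbertTensor_ext fun x w => by
    have : S.comp (htmulL x) = T.comp (htmulL x) :=
      hilbertTensor_ext fun y z => by simpa [htmulL_apply] using h x y z
    exact congrArg (fun F => F w) this

variable (H K L) in
/-- Conjugation by the associativity unitary. -/
def assocHom : (HilbertTensor (HilbertTensor H K) L →L[ℂ] HilbertTensor (HilbertTensor H K) L) →⋆ₐ[ℂ]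
    (HilbertTensor H (HilbertTensor K L) →L[ℂ] HilbertTensor H (HilbertTensor K L)) where
  toFun T := (hilbertAssoc H K L).conjStarAlgEquiv T
  map_one' := ContinuousLinearMap.ext fun x => (hilbertAssoc H K L).apply_symm_apply x
  map_mul' S T := (hilbertAssoc H K L).conjStarAlgEquiv.map_mul' S T
  map_zero' := ContinuousLinearMap.ext fun _ => map_zero (hilbertAssoc H K L)
  map_add' S T := (hilbertAssoc H K L).conjStarAlgEquiv.map_add' S T
  commutes' c := ContinuousLinearMap.ext fun x => by
    change hilbertAssoc H K L (c • (hilbertAssoc H K L).symm x) = c • x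
    rw [map_smul, LinearIsometryEquiv.apply_symm_apply]
  map_star' T := (hilbertAssoc H K L).conjStarAlgEquiv.map_star' T

theorem assocHom_apply (T : HilbertTensor (HilbertTensor H K) L →L[ℂ] HilbertTensor (HilbertTensor H K) L)
    (x : HilbertTensor H (HilbertTensor K L)) :
    assocHom H K L T x = hilbertAssoc H K L (T ((hilbertAssoc H K L).symm x)) := rfl

theorem assocHom_ampLeft_ampLeft (T : H →L[ℂ] H) :
    assocHom H K L (ampLeft _ L (ampLeft H K T)) = ampLeft H _ T :=
  hilbertTensor_ext₃ fun x y z => by simp [assocHom_apply]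

theorem assocHom_ampLeft_ampRight (T : K →L[ℂ] K) :
    assocHom H K L (ampLeft _ L (ampRight H K T)) = ampRight H _ (ampLeft K L T) :=
  hilbertTensor_ext₃ fun x y z => by simp [assocHom_apply]

theorem assocHom_ampRight (T : L →L[ℂ] L) :
    assocHom H K L (ampRight (HilbertTensor H K) L T) = ampRight H _ (ampRight K L T) :=
  hilbertTensor_ext₃ fun x y z => by simp [assocHom_apply]

theorem norm_ampLeft_le (T : H →L[ℂ] H) : ‖ampLeft H K T‖ ≤ ‖T‖ :=
  NonUnitalStarAlgHom.norm_apply_le (ampLeft H K) T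

theorem norm_ampRight_le (T : K →L[ℂ] K) : ‖ampRight H K T‖ ≤ ‖T‖ :=
  NonUnitalStarAlgHom.norm_apply_le (ampRight H K) T

theorem norm_assocHom_le
    (T : HilbertTensor (HilbertTensor H K) L →L[ℂ] HilbertTensor (HilbertTensor H K) L) :
    ‖assocHom H K L T‖ ≤ ‖T‖ :=
  NonUnitalStarAlgHom.norm_apply_le (assocHom H K L) T

end Hilbert

/-- A representation of a unital C*-algebra on a Hilbert space. -/
structure HilbertRep (A : Type u) [CStarAlgebra A] : Type (u + 1) where
  space : Type u
  [normed : NormedAddCommGroup space]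
  [innerProduct : InnerProductSpace ℂ space]
  [complete : CompleteSpace space]
  hom : A →⋆ₐ[ℂ] (space →L[ℂ] space)

attribute [instance] HilbertRep.normed HilbertRep.innerProduct HilbertRep.complete

section Spatial

variable {A B C D : Type u} [CStarAlgebra A] [CStarAlgebra B] [CStarAlgebra C] [CStarAlgebra D]
  {H K L : Type u} [NormedAddCommGroup H] [InnerProductSpace ℂ H] [CompleteSpace H]
  [NormedAddCommGroup K] [InnerProductSpace ℂ K] [CompleteSpace K]
  [NormedAddCommGroup L] [InnerProductSpace ℂ L] [CompleteSpace L]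

/-- The product representation `π ⊗ ρ` of the algebraic tensor product `A ⊗ B` on `H ⊗ K`. -/
def productRep (π : A →⋆ₐ[ℂ] (H →L[ℂ] H)) (ρ : B →⋆ₐ[ℂ] (K →L[ℂ] K)) :
    A ⊗[ℂ] B →⋆ₐ[ℂ] (HilbertTensor H K →L[ℂ] HilbertTensor H K) :=
  starTensorLift ((ampLeft H K).comp π) ((ampRight H K).comp ρ) fun _ _ => commute_amp _ _

/-- The product representation `π ⊗ ρ ⊗ σ` of the algebraic tensor product `A ⊗ B ⊗ C` on
`H ⊗ K ⊗ L`. -/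
def productRep₃ (π : A →⋆ₐ[ℂ] (H →L[ℂ] H)) (ρ : B →⋆ₐ[ℂ] (K →L[ℂ] K))
    (σ : C →⋆ₐ[ℂ] (L →L[ℂ] L)) :
    A ⊗[ℂ] (B ⊗[ℂ] C) →⋆ₐ[ℂ]
      (HilbertTensor H (HilbertTensor K L) →L[ℂ] HilbertTensor H (HilbertTensor K L)) :=
  starTensorLift ((ampLeft H _).comp π) ((ampRight H _).comp (productRep ρ σ))
    fun _ _ => commute_amp _ _

variable (A B C)

/-- The minimal (spatial) C*-seminorm `x ↦ sup ‖(π ⊗ ρ) x‖` on the algebraic tensor product, the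
supremum being over all representations `π` of `A` and `ρ` of `B` on Hilbert spaces. -/
def minSeminorm : CStarSeminorm (A ⊗[ℂ] B) :=
  CStarSeminorm.ofFamily
    (fun i : HilbertRep A × HilbertRep B => productRep i.1.hom i.2.hom) fun x => by
      obtain ⟨M, hM⟩ := exists_bound_tensor.{u} x
      exact ⟨M, by rintro _ ⟨i, rfl⟩; exact hM _ _⟩

/-- The minimal (spatial) C*-seminorm `x ↦ sup ‖(π ⊗ ρ ⊗ σ) x‖` on a threefold algebraic tensor
product. -/
def minSeminorm₃ : CStarSeminorm (A ⊗[ℂ] (B ⊗[ℂ] C)) :=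
  CStarSeminorm.ofFamily
    (fun i : HilbertRep A × HilbertRep B × HilbertRep C =>
      productRep₃ i.1.hom i.2.1.hom i.2.2.hom) fun x => by
      obtain ⟨M, hM⟩ := exists_bound_tensor₃.{u} x
      exact ⟨M, by rintro _ ⟨i, rfl⟩; exact hM _ _⟩

/-- The minimal (spatial) tensor product `A ⊗ B` of unital C*-algebras. -/
abbrev MinTensor : Type u := (minSeminorm A B).Compl

/-- The minimal (spatial) tensor product `A ⊗ B ⊗ C` of unital C*-algebras. -/
abbrev MinTensor₃ : Type u := (minSeminorm₃ A B C).Compl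

variable {A B C}

/-- The elementary tensor `a ⊗ b` in the minimal tensor product. -/
def mtmul (a : A) (b : B) : MinTensor A B := (minSeminorm A B).toCompl (a ⊗ₜ b)

/-- The elementary tensor `a ⊗ b ⊗ c` in the threefold minimal tensor product. -/
def mtmul₃ (a : A) (b : B) (c : C) : MinTensor₃ A B C :=
  (minSeminorm₃ A B C).toCompl (a ⊗ₜ (b ⊗ₜ c))

theorem minTensor_ext {f g : MinTensor A B →⋆ₐ[ℂ] D}
    (h : ∀ a b, f (mtmul a b) = g (mtmul a b)) : f = g := by
  refine (minSeminorm A B).starAlgHom_ext fun x => ?_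
  have : f.comp (minSeminorm A B).toCompl = g.comp (minSeminorm A B).toCompl := starTensor_ext h
  exact congrArg (fun F => F x) this

/-- The extension of `π ⊗ ρ` to the minimal tensor product. -/
def minRep (π : A →⋆ₐ[ℂ] (H →L[ℂ] H)) (ρ : B →⋆ₐ[ℂ] (K →L[ℂ] K)) :
    MinTensor A B →⋆ₐ[ℂ] (HilbertTensor H K →L[ℂ] HilbertTensor H K) :=
  (minSeminorm A B).lift (productRep π ρ) fun x =>
    CStarSeminorm.le_ofFamily
      (fun i : HilbertRep A × HilbertRep B => productRep i.1.hom i.2.hom) _ (⟨H, π⟩, ⟨K, ρ⟩) x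

/-- The extension of `π ⊗ ρ ⊗ σ` to the threefold minimal tensor product. -/
def minRep₃ (π : A →⋆ₐ[ℂ] (H →L[ℂ] H)) (ρ : B →⋆ₐ[ℂ] (K →L[ℂ] K)) (σ : C →⋆ₐ[ℂ] (L →L[ℂ] L)) :
    MinTensor₃ A B C →⋆ₐ[ℂ]
      (HilbertTensor H (HilbertTensor K L) →L[ℂ] HilbertTensor H (HilbertTensor K L)) :=
  (minSeminorm₃ A B C).lift (productRep₃ π ρ σ) fun x =>
    CStarSeminorm.le_ofFamily
      (fun i : HilbertRep A × HilbertRep B × HilbertRep C =>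
        productRep₃ i.1.hom i.2.1.hom i.2.2.hom) _ (⟨H, π⟩, ⟨K, ρ⟩, ⟨L, σ⟩) x

theorem minRep_toCompl (π : A →⋆ₐ[ℂ] (H →L[ℂ] H)) (ρ : B →⋆ₐ[ℂ] (K →L[ℂ] K)) (x : A ⊗[ℂ] B) :
    minRep π ρ ((minSeminorm A B).toCompl x) = productRep π ρ x :=
  (minSeminorm A B).lift_toCompl _ _ x

theorem minRep₃_toCompl (π : A →⋆ₐ[ℂ] (H →L[ℂ] H)) (ρ : B →⋆ₐ[ℂ] (K →L[ℂ] K))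
    (σ : C →⋆ₐ[ℂ] (L →L[ℂ] L)) (x : A ⊗[ℂ] (B ⊗[ℂ] C)) :
    minRep₃ π ρ σ ((minSeminorm₃ A B C).toCompl x) = productRep₃ π ρ σ x :=
  (minSeminorm₃ A B C).lift_toCompl _ _ x

theorem minRep_mtmul (π : A →⋆ₐ[ℂ] (H →L[ℂ] H)) (ρ : B →⋆ₐ[ℂ] (K →L[ℂ] K)) (a : A) (b : B) :
    minRep π ρ (mtmul a b) = ampLeft H K (π a) * ampRight H K (ρ b) :=
  minRep_toCompl π ρ _

theorem minRep₃_mtmul₃ (π : A →⋆ₐ[ℂ] (H →L[ℂ] H)) (ρ : B →⋆ₐ[ℂ] (K →L[ℂ] K))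
    (σ : C →⋆ₐ[ℂ] (L →L[ℂ] L)) (a : A) (b : B) (c : C) :
    minRep₃ π ρ σ (mtmul₃ a b c) =
      ampLeft H _ (π a) * ampRight H _ (ampLeft K L (ρ b) * ampRight K L (σ c)) :=
  minRep₃_toCompl π ρ σ _

theorem norm_minRep_le (π : A →⋆ₐ[ℂ] (H →L[ℂ] H)) (ρ : B →⋆ₐ[ℂ] (K →L[ℂ] K)) (x : A ⊗[ℂ] B) :
    ‖minRep π ρ ((minSeminorm A B).toCompl x)‖ ≤ minSeminorm A B x := by
  rw [← (minSeminorm A B).norm_toCompl]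
  exact NonUnitalStarAlgHom.norm_apply_le (minRep π ρ) _

/-- The product representations determine the norm of the threefold minimal tensor product. -/
theorem norm_le_of_minRep₃ (x : MinTensor₃ A B C) {M : ℝ} (hM : 0 ≤ M)
    (h : ∀ (π : HilbertRep A) (ρ : HilbertRep B) (σ : HilbertRep C),
      ‖minRep₃ π.hom ρ.hom σ.hom x‖ ≤ M) : ‖x‖ ≤ M := by
  refine le_of_forall_pos_le_add fun ε hε => ?_
  obtain ⟨y, hy⟩ := (minSeminorm₃ A B C).denseRange_toCompl.exists_dist_lt x (half_pos hε)
  rw [dist_eq_norm] at hy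
  have h1 : ‖(minSeminorm₃ A B C).toCompl y‖ ≤ M + ε / 2 := by
    rw [CStarSeminorm.norm_toCompl]
    refine CStarSeminorm.ofFamily_le _ _ y (by positivity) fun i => ?_
    have h2 := h i.1 i.2.1 i.2.2
    have h3 := NonUnitalStarAlgHom.norm_apply_le (minRep₃ i.1.hom i.2.1.hom i.2.2.hom)
      (x - (minSeminorm₃ A B C).toCompl y)
    rw [map_sub, minRep₃_toCompl] at h3
    have h4 := norm_le_norm_add_norm_sub (minRep₃ i.1.hom i.2.1.hom i.2.2.hom x)
      (productRep₃ i.1.hom i.2.1.hom i.2.2.hom y)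
    linarith
  have h4 := norm_le_norm_add_norm_sub' x ((minSeminorm₃ A B C).toCompl y)
  linarith

variable (A B C)

/-- The embedding `a ↦ a ⊗ 1 ⊗ 1`. -/
def firstLeg : A →⋆ₐ[ℂ] MinTensor₃ A B C :=
  (minSeminorm₃ A B C).toCompl.comp (starInclLeft A (B ⊗[ℂ] C))

/-- The embedding `c ↦ 1 ⊗ 1 ⊗ c`. -/
def lastLeg : C →⋆ₐ[ℂ] MinTensor₃ A B C :=
  (minSeminorm₃ A B C).toCompl.comp ((starInclRight A (B ⊗[ℂ] C)).comp (starInclRight B C))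

/-- The embedding `b ⊗ c ↦ 1 ⊗ b ⊗ c`, on the algebraic tensor product. -/
def lastTwoLegsAux : B ⊗[ℂ] C →⋆ₐ[ℂ] MinTensor₃ A B C :=
  (minSeminorm₃ A B C).toCompl.comp (starInclRight A (B ⊗[ℂ] C))

/-- The embedding `a ⊗ b ↦ a ⊗ b ⊗ 1`, on the algebraic tensor product. -/
def firstTwoLegsAux : A ⊗[ℂ] B →⋆ₐ[ℂ] MinTensor₃ A B C :=
  (minSeminorm₃ A B C).toCompl.comp
    (starTensorLift (starInclLeft A (B ⊗[ℂ] C))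
      ((starInclRight A (B ⊗[ℂ] C)).comp (starInclLeft B C)) fun a b => by
        simp [Commute, SemiconjBy])

variable {A B C}

theorem firstTwoLegsAux_tmul (a : A) (b : B) :
    firstTwoLegsAux A B C (a ⊗ₜ b) = mtmul₃ a b 1 := by
  change (minSeminorm₃ A B C).toCompl ((a ⊗ₜ[ℂ] 1) * (1 ⊗ₜ[ℂ] (b ⊗ₜ[ℂ] 1))) = _
  rw [Algebra.TensorProduct.tmul_mul_tmul, mul_one, one_mul]
  rfl

theorem minRep₃_firstLeg (π : A →⋆ₐ[ℂ] (H →L[ℂ] H)) (ρ : B →⋆ₐ[ℂ] (K →L[ℂ] K))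
    (σ : C →⋆ₐ[ℂ] (L →L[ℂ] L)) (a : A) :
    minRep₃ π ρ σ (firstLeg A B C a) = ampLeft H _ (π a) := by
  have : firstLeg A B C a = mtmul₃ a 1 1 := rfl
  rw [this, minRep₃_mtmul₃]
  simp

theorem minRep₃_lastLeg (π : A →⋆ₐ[ℂ] (H →L[ℂ] H)) (ρ : B →⋆ₐ[ℂ] (K →L[ℂ] K))
    (σ : C →⋆ₐ[ℂ] (L →L[ℂ] L)) (c : C) :
    minRep₃ π ρ σ (lastLeg A B C c) = ampRight H _ (ampRight K L (σ c)) := by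
  have : lastLeg A B C c = mtmul₃ 1 1 c := rfl
  rw [this, minRep₃_mtmul₃]
  simp

theorem minRep₃_lastTwoLegsAux (π : A →⋆ₐ[ℂ] (H →L[ℂ] H)) (ρ : B →⋆ₐ[ℂ] (K →L[ℂ] K))
    (σ : C →⋆ₐ[ℂ] (L →L[ℂ] L)) (x : B ⊗[ℂ] C) :
    minRep₃ π ρ σ (lastTwoLegsAux A B C x) =
      ampRight H _ (minRep ρ σ ((minSeminorm B C).toCompl x)) := by
  have h : (minRep₃ π ρ σ).comp (lastTwoLegsAux A B C) =
      (ampRight H _).comp ((minRep ρ σ).comp (minSeminorm B C).toCompl) := by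
    refine starTensor_ext fun b c => ?_
    change minRep₃ π ρ σ (mtmul₃ 1 b c) = ampRight H _ (minRep ρ σ (mtmul b c))
    rw [minRep₃_mtmul₃, minRep_mtmul]
    simp
  exact congrArg (fun F => F x) h

theorem minRep₃_firstTwoLegsAux (π : A →⋆ₐ[ℂ] (H →L[ℂ] H)) (ρ : B →⋆ₐ[ℂ] (K →L[ℂ] K))
    (σ : C →⋆ₐ[ℂ] (L →L[ℂ] L)) (x : A ⊗[ℂ] B) :
    minRep₃ π ρ σ (firstTwoLegsAux A B C x) =
      assocHom H K L
        (ampLeft _ L (minRep π ρ ((minSeminorm A B).toCompl x))) := by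
  have h : (minRep₃ π ρ σ).comp (firstTwoLegsAux A B C) =
      (assocHom H K L).comp
        ((ampLeft _ L).comp ((minRep π ρ).comp (minSeminorm A B).toCompl)) := by
    refine starTensor_ext fun a b => ?_
    change minRep₃ π ρ σ (firstTwoLegsAux A B C (a ⊗ₜ b)) =
      assocHom H K L (ampLeft _ L (minRep π ρ (mtmul a b)))
    rw [firstTwoLegsAux_tmul, minRep₃_mtmul₃, minRep_mtmul, map_mul (ampLeft (HilbertTensor H K) L),
      map_mul (assocHom H K L), assocHom_ampLeft_ampLeft, assocHom_ampLeft_ampRight, map_one σ,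
      map_one (ampRight K L), mul_one]
  exact congrArg (fun F => F x) h

variable (A B C)

/-- The embedding `b ⊗ c ↦ 1 ⊗ b ⊗ c`. -/
def lastTwoLegs : MinTensor B C →⋆ₐ[ℂ] MinTensor₃ A B C :=
  (minSeminorm B C).lift (lastTwoLegsAux A B C) fun x => by
    refine norm_le_of_minRep₃ _ ((minSeminorm B C).nonneg x) fun π ρ σ => ?_
    rw [minRep₃_lastTwoLegsAux]
    exact (norm_ampRight_le _).trans (norm_minRep_le _ _ x)

/-- The embedding `a ⊗ b ↦ a ⊗ b ⊗ 1`. -/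
def firstTwoLegs : MinTensor A B →⋆ₐ[ℂ] MinTensor₃ A B C :=
  (minSeminorm A B).lift (firstTwoLegsAux A B C) fun x => by
    refine norm_le_of_minRep₃ _ ((minSeminorm A B).nonneg x) fun π ρ σ => ?_
    rw [minRep₃_firstTwoLegsAux]
    exact (norm_assocHom_le _).trans
      ((norm_ampLeft_le _).trans (norm_minRep_le _ _ x))

variable {A B C}

theorem lastTwoLegs_toCompl (x : B ⊗[ℂ] C) :
    lastTwoLegs A B C ((minSeminorm B C).toCompl x) = lastTwoLegsAux A B C x :=
  (minSeminorm B C).lift_toCompl _ _ x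

theorem firstTwoLegs_toCompl (x : A ⊗[ℂ] B) :
    firstTwoLegs A B C ((minSeminorm A B).toCompl x) = firstTwoLegsAux A B C x :=
  (minSeminorm A B).lift_toCompl _ _ x

@[simp]
theorem lastTwoLegs_mtmul (b : B) (c : C) : lastTwoLegs A B C (mtmul b c) = mtmul₃ 1 b c :=
  (minSeminorm B C).lift_toCompl _ _ _

@[simp]
theorem firstTwoLegs_mtmul (a : A) (b : B) : firstTwoLegs A B C (mtmul a b) = mtmul₃ a b 1 := by
  exact ((minSeminorm A B).lift_toCompl _ _ _).trans (firstTwoLegsAux_tmul a b)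

theorem minRep₃_lastTwoLegs (π : A →⋆ₐ[ℂ] (H →L[ℂ] H)) (ρ : B →⋆ₐ[ℂ] (K →L[ℂ] K))
    (σ : C →⋆ₐ[ℂ] (L →L[ℂ] L)) (x : MinTensor B C) :
    minRep₃ π ρ σ (lastTwoLegs A B C x) = ampRight H _ (minRep ρ σ x) := by
  have h : (minRep₃ π ρ σ).comp (lastTwoLegs A B C) = (ampRight H _).comp (minRep ρ σ) := by
    refine minTensor_ext fun b c => ?_
    simp only [StarAlgHom.comp_apply, lastTwoLegs_mtmul, minRep₃_mtmul₃, minRep_mtmul]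
    simp
  exact congrArg (fun F => F x) h

theorem minRep₃_firstTwoLegs (π : A →⋆ₐ[ℂ] (H →L[ℂ] H)) (ρ : B →⋆ₐ[ℂ] (K →L[ℂ] K))
    (σ : C →⋆ₐ[ℂ] (L →L[ℂ] L)) (x : MinTensor A B) :
    minRep₃ π ρ σ (firstTwoLegs A B C x) =
      assocHom H K L (ampLeft _ L (minRep π ρ x)) := by
  have h : (minRep₃ π ρ σ).comp (firstTwoLegs A B C) =
      (assocHom H K L).comp
        ((ampLeft _ L).comp (minRep π ρ)) := by
    refine (minSeminorm A B).starAlgHom_ext fun y => ?_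
    refine Eq.trans ?_ (minRep₃_firstTwoLegsAux π ρ σ y)
    exact congrArg (minRep₃ π ρ σ) (firstTwoLegs_toCompl y)
  exact congrArg (fun F => F x) h

theorem commute_first_lastTwo (a : A) (x : MinTensor B C) :
    Commute (firstLeg A B C a) (lastTwoLegs A B C x) := by
  refine (minSeminorm B C).denseRange_toCompl.induction_on x ?_ fun y => ?_
  · have hc := starAlgHom_continuous (lastTwoLegs A B C)
    exact isClosed_eq (continuous_const.mul hc) (hc.mul continuous_const)
  · have e : lastTwoLegs A B C ((minSeminorm B C).toCompl y) = lastTwoLegsAux A B C y :=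
      (minSeminorm B C).lift_toCompl _ _ y
    rw [e]
    have : Commute (starInclLeft A (B ⊗[ℂ] C) a) (starInclRight A (B ⊗[ℂ] C) y) := by
      simp [Commute, SemiconjBy]
    exact this.map (minSeminorm₃ A B C).toCompl

theorem commute_firstTwo_last (x : MinTensor A B) (c : C) :
    Commute (firstTwoLegs A B C x) (lastLeg A B C c) := by
  refine (minSeminorm A B).denseRange_toCompl.induction_on x ?_ fun y => ?_
  · have hc := starAlgHom_continuous (firstTwoLegs A B C)
    exact isClosed_eq (hc.mul continuous_const) (continuous_const.mul hc)
  · induction y using TensorProduct.induction_on with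
    | zero => simp
    | add y z hy hz => rw [map_add, map_add]; exact hy.add_left hz
    | tmul a b =>
      have e : firstTwoLegs A B C ((minSeminorm A B).toCompl (a ⊗ₜ b)) = mtmul₃ a b 1 :=
        firstTwoLegs_mtmul a b
      rw [e]
      have : Commute (a ⊗ₜ[ℂ] (b ⊗ₜ[ℂ] (1 : C))) ((1 : A) ⊗ₜ[ℂ] ((1 : B) ⊗ₜ[ℂ] c)) := by
        simp [Commute, SemiconjBy]
      exact this.map (minSeminorm₃ A B C).toCompl

/-- `f ⊗ id : D ⊗ C → A ⊗ B ⊗ C` for a `*`-homomorphism `f : D → A ⊗ B`. -/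
def mapFirst (f : D →⋆ₐ[ℂ] MinTensor A B) : MinTensor D C →⋆ₐ[ℂ] MinTensor₃ A B C :=
  (minSeminorm D C).lift
    (starTensorLift ((firstTwoLegs A B C).comp f) (lastLeg A B C)
      fun _ _ => commute_firstTwo_last _ _) fun x => by
    refine norm_le_of_minRep₃ _ ((minSeminorm D C).nonneg x) fun π ρ σ => ?_
    have h : (minRep₃ π.hom ρ.hom σ.hom).comp (starTensorLift ((firstTwoLegs A B C).comp f)
        (lastLeg A B C) fun _ _ => commute_firstTwo_last _ _) =
      (assocHom π.space ρ.space σ.space).comp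
        ((minRep ((minRep π.hom ρ.hom).comp f) σ.hom).comp (minSeminorm D C).toCompl) := by
      refine starTensor_ext fun d c => ?_
      change minRep₃ π.hom ρ.hom σ.hom (firstTwoLegs A B C (f d) * lastLeg A B C c) =
        assocHom π.space ρ.space σ.space
          (minRep ((minRep π.hom ρ.hom).comp f) σ.hom (mtmul d c))
      rw [map_mul, minRep₃_firstTwoLegs, minRep₃_lastLeg, minRep_mtmul, map_mul, assocHom_ampRight]
      rfl
    have hx := congrArg (fun F => ‖F x‖) h
    refine hx.le.trans ?_
    exact (norm_assocHom_le _).trans (norm_minRep_le _ _ x)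

/-- `id ⊗ f : A ⊗ D → A ⊗ B ⊗ C` for a `*`-homomorphism `f : D → B ⊗ C`. -/
def mapLast (f : D →⋆ₐ[ℂ] MinTensor B C) : MinTensor A D →⋆ₐ[ℂ] MinTensor₃ A B C :=
  (minSeminorm A D).lift
    (starTensorLift (firstLeg A B C) ((lastTwoLegs A B C).comp f)
      fun _ _ => commute_first_lastTwo _ _) fun x => by
    refine norm_le_of_minRep₃ _ ((minSeminorm A D).nonneg x) fun π ρ σ => ?_
    have h : (minRep₃ π.hom ρ.hom σ.hom).comp (starTensorLift (firstLeg A B C)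
        ((lastTwoLegs A B C).comp f) fun _ _ => commute_first_lastTwo _ _) =
      (minRep π.hom ((minRep ρ.hom σ.hom).comp f)).comp (minSeminorm A D).toCompl := by
      refine starTensor_ext fun a d => ?_
      change minRep₃ π.hom ρ.hom σ.hom (firstLeg A B C a * lastTwoLegs A B C (f d)) =
        minRep π.hom ((minRep ρ.hom σ.hom).comp f) (mtmul a d)
      rw [map_mul, minRep₃_firstLeg, minRep₃_lastTwoLegs, minRep_mtmul]
      rfl
    have hx := congrArg (fun F => ‖F x‖) h
    exact hx.le.trans (norm_minRep_le _ _ x)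

theorem mapFirst_mtmul (f : D →⋆ₐ[ℂ] MinTensor A B) (d : D) (c : C) :
    mapFirst f (mtmul d c) = firstTwoLegs A B C (f d) * lastLeg A B C c :=
  (minSeminorm D C).lift_toCompl _ _ _

theorem mapLast_mtmul (f : D →⋆ₐ[ℂ] MinTensor B C) (a : A) (d : D) :
    mapLast f (mtmul a d) = firstLeg A B C a * lastTwoLegs A B C (f d) :=
  (minSeminorm A D).lift_toCompl _ _ _

end Spatial

/-- A compact quantum group structure on a unital C*-algebra `C`: a unital `*`-homomorphism
`Δ : C → C ⊗ C` into the minimal tensor product which is coassociative,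
`(Δ ⊗ id) ∘ Δ = (id ⊗ Δ) ∘ Δ`, and such that the linear spans of `{(a ⊗ 1) Δ(b)}` and of
`{(1 ⊗ a) Δ(b)}` are dense in `C ⊗ C`. -/
structure CompactQuantumGroupStructure (C : Type u) [CStarAlgebra C] where
  comul : C →⋆ₐ[ℂ] MinTensor C C
  coassoc : (mapFirst comul).comp comul = (mapLast comul).comp comul
  dense_left : Dense (Submodule.span ℂ
    {x : MinTensor C C | ∃ a b : C, x = mtmul a 1 * comul b} : Set (MinTensor C C))
  dense_right : Dense (Submodule.span ℂ
    {x : MinTensor C C | ∃ a b : C, x = mtmul 1 a * comul b} : Set (MinTensor C C))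

/-- `(C, Φ)` is the quantum space of all maps from the quantum space of the finite-dimensional
C*-algebra `B` to the quantum space of the unital C*-algebra `A`: every unital `*`-homomorphism
`Ψ : A → B ⊗ D`, with `D` a unital C*-algebra, is `(id ⊗ Λ) ∘ Φ` for exactly one unital
`*`-homomorphism `Λ : C → D`. Since `B` is finite-dimensional, `B ⊗ D` is the algebraic tensor
product; of `A` and `B` only the `*`-algebra structure enters. -/
def IsQuantumSpaceOfMaps {A B : Type*} {C : Type u} [Ring A] [StarRing A] [Algebra ℂ A]
    [Ring B] [StarRing B] [Algebra ℂ B] [StarModule ℂ B] [FiniteDimensional ℂ B] [CStarAlgebra C]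
    (Φ : A →⋆ₐ[ℂ] B ⊗[ℂ] C) : Prop :=
  ∀ (D : Type u) [CStarAlgebra D] (Ψ : A →⋆ₐ[ℂ] B ⊗[ℂ] D),
    ∃! Λ : C →⋆ₐ[ℂ] D,
      ∀ a : A, Algebra.TensorProduct.map (AlgHom.id ℂ B) (Λ : C →ₐ[ℂ] D) (Φ a) = Ψ a

end

/-! The obstruction lives in the classical points of the quantum space, that is, in the characters
of `C`.

Testing the universal property against one-dimensional algebras identifies the characters of `C`
with the unital `*`-homomorphisms `ℂ² → M₂(ℂ)`, hence with the projections in `M₂(ℂ)`. Explicitly,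
`χ` corresponds to the slice by `χ` of the image under `Φ` of the first minimal projection, so the
identification is continuous from the weak-* topology to the matrix topology. The projections
consist of two isolated points, `0` and `1`, and the infinite family of rank-one projections.

A compact quantum group structure would make the characters a compact semigroup under convolution:
coassociativity gives associativity, and the two density conditions give cancellation on the two
sides (`conv_left_cancel`, `conv_right_cancel`). Such a semigroup is a group, by the Ellis–Numakura
idempotent theorem, and therefore homogeneous: one isolated point makes it discrete, and compactness
makes it finite (`finite_of_compact_cancel`). The character corresponding to the projection `0` is
isolated, yet there are infinitely many characters. This is a contradiction. -/

noncomputable section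

/-! ### Compact cancellative semigroups. -/

section Semigroup

/-- In a compact Hausdorff cancellative semigroup with continuous right translations the left
translations are surjective. -/
theorem exists_mul_eq_of_compact_cancel {M : Type*} [Semigroup M] [IsCancelMul M]
    [TopologicalSpace M] [CompactSpace M] [T2Space M] (hc : ∀ r : M, Continuous (· * r))
    (x y : M) : ∃ z, x * z = y := by
  have : Nonempty M := ⟨x⟩
  obtain ⟨e, he⟩ := exists_idempotent_of_compact_t2_of_continuous_mul_left hc
  -- In a cancellative semigroup an idempotent is a two-sided identity.
  have one_mul' : ∀ a, e * a = a := fun a => mul_left_cancel (a := e) (by rw [← mul_assoc, he])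
  have mul_one' : ∀ a, a * e = a := fun a => mul_right_cancel (b := e) (by rw [mul_assoc, he])
  have left_inv : ∀ a : M, ∃ b, b * a = e := fun a => by
    -- The left ideal `M * a` is a compact subsemigroup, so it contains an idempotent `m = b * a`;
    -- cancelling in `m * m = m * e` gives `m = e`.
    obtain ⟨m, ⟨b, hb⟩, hm⟩ := exists_idempotent_in_compact_subsemigroup hc
      (Set.range (· * a)) (Set.range_nonempty _) (isCompact_range (hc a)) (by
        rintro _ ⟨b, rfl⟩ _ ⟨c, rfl⟩
        exact ⟨b * a * c, by simp only [mul_assoc]⟩)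
    refine ⟨b, hb.trans (mul_left_cancel (a := m) ?_)⟩
    rw [hm, mul_one']
  obtain ⟨w, hw⟩ := left_inv x
  refine ⟨w * y, ?_⟩
  -- The left inverse `w` of `x` has itself a left inverse `v`, and `v = v * (w * x) = x`, so `w` is
  -- also a right inverse of `x`.
  obtain ⟨v, hv⟩ := left_inv w
  have hvx : v = x := by
    rw [← mul_one' v, ← hw, ← mul_assoc, hv, one_mul']
  rw [← mul_assoc, ← hvx, hv, one_mul']

/-- A compact Hausdorff cancellative semigroup with continuous right translations is finite as soon
as it has an isolated point. -/
theorem finite_of_compact_cancel {M : Type*} [Semigroup M] [IsCancelMul M]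
    [TopologicalSpace M] [CompactSpace M] [T2Space M] (hc : ∀ r : M, Continuous (· * r))
    (y : M) (hy : IsOpen {y}) : Finite M := by
  have : DiscreteTopology M := discreteTopology_iff_isOpen_singleton.mpr fun x => by
    obtain ⟨z, hz⟩ := exists_mul_eq_of_compact_cancel hc x y
    -- Right translation by `z` is continuous and injective and carries `x` to `y`, so it pulls the
    -- isolated point `y` back to `x`.
    have h : {x} = (· * z) ⁻¹' {y} := by
      ext t
      simp only [Set.mem_singleton_iff, Set.mem_preimage, ← hz]
      exact ⟨fun h => h ▸ rfl, fun h => mul_right_cancel h⟩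
    exact h ▸ hy.preimage (hc z)
  exact finite_of_compact_of_discrete

end Semigroup

/-! ### Products of characters on minimal tensor products. -/

section Characters

variable {A B C : Type u} [CStarAlgebra A] [CStarAlgebra B] [CStarAlgebra C]

/-- The one-dimensional Hilbert space in an arbitrary universe. -/
abbrev UnitHilbert : Type u := EuclideanSpace ℂ PUnit.{u + 1}

/-- A character, as a representation by scalar operators on `H`. -/
def scalarRep (H : Type*) [NormedAddCommGroup H] [InnerProductSpace ℂ H] [CompleteSpace H]
    (χ : A →⋆ₐ[ℂ] ℂ) : A →⋆ₐ[ℂ] (H →L[ℂ] H) :=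
  (StarAlgHom.ofId ℂ (H →L[ℂ] H)).comp χ

/-- The product of two characters on the algebraic tensor product. -/
def tensorChar (χ : A →⋆ₐ[ℂ] ℂ) (ψ : B →⋆ₐ[ℂ] ℂ) : A ⊗[ℂ] B →⋆ₐ[ℂ] ℂ :=
  starTensorLift χ ψ fun _ _ => Commute.all _ _

/-- The norm of an elementary tensor is the product of the norms. Nontriviality ensures that a
scalar operator has norm equal to the modulus of its scalar. -/
instance nontrivial_hilbertTensor {H K : Type*} [NormedAddCommGroup H] [InnerProductSpace ℂ H]
    [CompleteSpace H] [NormedAddCommGroup K] [InnerProductSpace ℂ K] [CompleteSpace K]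
    [Nontrivial H] [Nontrivial K] : Nontrivial (HilbertTensor H K) := by
  obtain ⟨x, hx⟩ := exists_ne (0 : H)
  obtain ⟨y, hy⟩ := exists_ne (0 : K)
  refine ⟨htmul x y, 0, fun h => ?_⟩
  have h' : ‖htmul x y‖ = ‖x‖ * ‖y‖ := by
    rw [htmul, LinearIsometry.norm_map, TensorProduct.norm_tmul]
  rw [h, norm_zero, eq_comm, mul_eq_zero, norm_eq_zero, norm_eq_zero] at h'
  exact h'.elim hx hy

/-- Amplifications of scalars are scalars. This exhibits the product of two characters as one of the
product representations defining the minimal norm, so that it is bounded for that norm. -/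
theorem productRep_scalarRep (χ : A →⋆ₐ[ℂ] ℂ) (ψ : B →⋆ₐ[ℂ] ℂ)
    (H K : Type u) [NormedAddCommGroup H] [InnerProductSpace ℂ H]
    [CompleteSpace H] [NormedAddCommGroup K] [InnerProductSpace ℂ K] [CompleteSpace K] :
    productRep (scalarRep H χ) (scalarRep K ψ) =
      (StarAlgHom.ofId ℂ (HilbertTensor H K →L[ℂ] HilbertTensor H K)).comp (tensorChar χ ψ) := by
  refine starTensor_ext fun a b => ?_
  change ampLeft H K (algebraMap ℂ _ (χ a)) * ampRight H K (algebraMap ℂ _ (ψ b)) =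
    algebraMap ℂ _ (χ a * ψ b)
  rw [AlgHomClass.commutes, AlgHomClass.commutes, map_mul]

/-- The product `χ ⊗ ψ` of two characters on the minimal tensor product. -/
def prodChar (χ : A →⋆ₐ[ℂ] ℂ) (ψ : B →⋆ₐ[ℂ] ℂ) : MinTensor A B →⋆ₐ[ℂ] ℂ :=
  (minSeminorm A B).lift (tensorChar χ ψ) fun x => by
    have h := CStarSeminorm.le_ofFamily
      (fun i : HilbertRep A × HilbertRep B => productRep i.1.hom i.2.hom)
      (fun x => by
        obtain ⟨M, hM⟩ := exists_bound_tensor.{u} x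
        exact ⟨M, by rintro _ ⟨i, rfl⟩; exact hM _ _⟩)
      (⟨UnitHilbert, scalarRep _ χ⟩, ⟨UnitHilbert, scalarRep _ ψ⟩) x
    -- The modulus of the product character at `x` is the norm of the corresponding scalar operator.
    refine le_trans (le_of_eq ?_) h
    change _ = ‖productRep (scalarRep UnitHilbert χ) (scalarRep UnitHilbert ψ) x‖
    rw [productRep_scalarRep]
    change _ = ‖algebraMap ℂ _ (tensorChar χ ψ x)‖
    rw [norm_algebraMap']

@[simp]
theorem prodChar_mtmul (χ : A →⋆ₐ[ℂ] ℂ) (ψ : B →⋆ₐ[ℂ] ℂ) (a : A) (b : B) :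
    prodChar χ ψ (mtmul a b) = χ a * ψ b :=
  (minSeminorm A B).lift_toCompl _ _ _

/-- A form of `minTensor_ext` whose target may lie in another universe, as is needed for the target
`ℂ`. -/
theorem minTensor_starAlgHom_ext {D : Type*} [CStarAlgebra D] {f g : MinTensor A B →⋆ₐ[ℂ] D}
    (h : ∀ a b, f (mtmul a b) = g (mtmul a b)) : f = g := by
  refine (minSeminorm A B).starAlgHom_ext fun x => ?_
  have : f.comp (minSeminorm A B).toCompl = g.comp (minSeminorm A B).toCompl := starTensor_ext h
  exact congrArg (fun F => F x) this

theorem prodChar_toCompl (χ : A →⋆ₐ[ℂ] ℂ) (ψ : B →⋆ₐ[ℂ] ℂ) (x : A ⊗[ℂ] B) :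
    prodChar χ ψ ((minSeminorm A B).toCompl x) = tensorChar χ ψ x :=
  (minSeminorm A B).lift_toCompl _ _ _

/-- The product of three characters on the algebraic tensor product. -/
def tensorChar₃ (χ : A →⋆ₐ[ℂ] ℂ) (ψ : B →⋆ₐ[ℂ] ℂ) (ω : C →⋆ₐ[ℂ] ℂ) :
    A ⊗[ℂ] (B ⊗[ℂ] C) →⋆ₐ[ℂ] ℂ :=
  starTensorLift χ (tensorChar ψ ω) fun _ _ => Commute.all _ _

theorem productRep₃_scalarRep (χ : A →⋆ₐ[ℂ] ℂ) (ψ : B →⋆ₐ[ℂ] ℂ) (ω : C →⋆ₐ[ℂ] ℂ)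
    (H K L : Type u) [NormedAddCommGroup H] [InnerProductSpace ℂ H]
    [CompleteSpace H] [NormedAddCommGroup K] [InnerProductSpace ℂ K] [CompleteSpace K]
    [NormedAddCommGroup L] [InnerProductSpace ℂ L] [CompleteSpace L] :
    productRep₃ (scalarRep H χ) (scalarRep K ψ) (scalarRep L ω) =
      (StarAlgHom.ofId ℂ (HilbertTensor H (HilbertTensor K L) →L[ℂ]
        HilbertTensor H (HilbertTensor K L))).comp
        (tensorChar₃ χ ψ ω) := by
  refine starTensor_ext fun a y => ?_
  change ampLeft H _ (algebraMap ℂ _ (χ a)) *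
    ampRight H _ (productRep (scalarRep K ψ) (scalarRep L ω) y) =
    algebraMap ℂ _ (χ a * tensorChar ψ ω y)
  rw [productRep_scalarRep]
  change _ * ampRight H _ (algebraMap ℂ _ (tensorChar ψ ω y)) = _
  rw [AlgHomClass.commutes, AlgHomClass.commutes, map_mul]

/-- The product `χ ⊗ ψ ⊗ ω` of three characters on the threefold minimal tensor product. -/
def prodChar₃ (χ : A →⋆ₐ[ℂ] ℂ) (ψ : B →⋆ₐ[ℂ] ℂ) (ω : C →⋆ₐ[ℂ] ℂ) :
    MinTensor₃ A B C →⋆ₐ[ℂ] ℂ :=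
  (minSeminorm₃ A B C).lift (tensorChar₃ χ ψ ω) fun x => by
    have h := CStarSeminorm.le_ofFamily
      (fun i : HilbertRep A × HilbertRep B × HilbertRep C =>
        productRep₃ i.1.hom i.2.1.hom i.2.2.hom)
      (fun x => by
        obtain ⟨M, hM⟩ := exists_bound_tensor₃.{u} x
        exact ⟨M, by rintro _ ⟨i, rfl⟩; exact hM _ _⟩)
      (⟨UnitHilbert, scalarRep _ χ⟩, ⟨UnitHilbert, scalarRep _ ψ⟩,
        ⟨UnitHilbert, scalarRep _ ω⟩) x
    refine le_trans (le_of_eq ?_) h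
    change _ = ‖productRep₃ (scalarRep UnitHilbert χ) (scalarRep UnitHilbert ψ)
      (scalarRep UnitHilbert ω) x‖
    rw [productRep₃_scalarRep]
    change _ = ‖algebraMap ℂ _ (tensorChar₃ χ ψ ω x)‖
    rw [norm_algebraMap']

@[simp]
theorem prodChar₃_mtmul₃ (χ : A →⋆ₐ[ℂ] ℂ) (ψ : B →⋆ₐ[ℂ] ℂ) (ω : C →⋆ₐ[ℂ] ℂ)
    (a : A) (b : B) (c : C) : prodChar₃ χ ψ ω (mtmul₃ a b c) = χ a * (ψ b * ω c) :=
  (minSeminorm₃ A B C).lift_toCompl _ _ _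

theorem prodChar₃_firstTwoLegs (χ : A →⋆ₐ[ℂ] ℂ) (ψ : B →⋆ₐ[ℂ] ℂ) (ω : C →⋆ₐ[ℂ] ℂ)
    (x : MinTensor A B) : prodChar₃ χ ψ ω (firstTwoLegs A B C x) = prodChar χ ψ x := by
  have h : (prodChar₃ χ ψ ω).comp (firstTwoLegs A B C) = prodChar χ ψ :=
    minTensor_starAlgHom_ext fun a b => by simp
  exact congrArg (fun F => F x) h

theorem prodChar₃_lastTwoLegs (χ : A →⋆ₐ[ℂ] ℂ) (ψ : B →⋆ₐ[ℂ] ℂ) (ω : C →⋆ₐ[ℂ] ℂ)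
    (x : MinTensor B C) : prodChar₃ χ ψ ω (lastTwoLegs A B C x) = prodChar ψ ω x := by
  have h : (prodChar₃ χ ψ ω).comp (lastTwoLegs A B C) = prodChar ψ ω :=
    minTensor_starAlgHom_ext fun a b => by simp
  exact congrArg (fun F => F x) h

/-- Together with `prodChar₃_comp_mapLast`, this turns the two sides of coassociativity into the two
bracketings of a triple convolution. -/
theorem prodChar₃_comp_mapFirst {D : Type u} [CStarAlgebra D] (χ : A →⋆ₐ[ℂ] ℂ) (ψ : B →⋆ₐ[ℂ] ℂ)
    (ω : C →⋆ₐ[ℂ] ℂ) (f : D →⋆ₐ[ℂ] MinTensor A B) :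
    (prodChar₃ χ ψ ω).comp (mapFirst f) = prodChar ((prodChar χ ψ).comp f) ω :=
  minTensor_starAlgHom_ext fun d c => by
    have h : lastLeg A B C c = mtmul₃ 1 1 c := rfl
    rw [StarAlgHom.comp_apply, mapFirst_mtmul, map_mul, prodChar₃_firstTwoLegs, h]
    simp

theorem prodChar₃_comp_mapLast {D : Type u} [CStarAlgebra D] (χ : A →⋆ₐ[ℂ] ℂ) (ψ : B →⋆ₐ[ℂ] ℂ)
    (ω : C →⋆ₐ[ℂ] ℂ) (f : D →⋆ₐ[ℂ] MinTensor B C) :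
    (prodChar₃ χ ψ ω).comp (mapLast f) = prodChar χ ((prodChar ψ ω).comp f) :=
  minTensor_starAlgHom_ext fun a d => by
    have h : firstLeg A B C a = mtmul₃ a 1 1 := rfl
    rw [StarAlgHom.comp_apply, mapLast_mtmul, map_mul, prodChar₃_lastTwoLegs, h]
    simp

/-- Characters are unital, so each factor is recovered by restriction to `a ⊗ 1` or `1 ⊗ b`. -/
theorem prodChar_injective {χ χ' : A →⋆ₐ[ℂ] ℂ} {ψ ψ' : B →⋆ₐ[ℂ] ℂ}
    (h : prodChar χ ψ = prodChar χ' ψ') : χ = χ' ∧ ψ = ψ' := by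
  constructor
  · ext a
    simpa using congrArg (fun F => F (mtmul a 1)) h
  · ext b
    simpa using congrArg (fun F => F (mtmul 1 b)) h

end Characters

/-! ### The weak-* topology on characters. -/

section CharacterSpace

open WeakDual

/-- The characters of a C*-algebra are its `*`-homomorphisms to `ℂ`. -/
def charEquiv (C : Type*) [CStarAlgebra C] : characterSpace ℂ C ≃ (C →⋆ₐ[ℂ] ℂ) where
  toFun χ := { CharacterSpace.toAlgHom χ with map_star' := fun x => map_star χ x }
  invFun f := CharacterSpace.equivAlgHom.symm (f : C →ₐ[ℂ] ℂ)
  left_inv _ := rfl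
  right_inv _ := rfl

theorem continuous_eval_character {C : Type*} [CStarAlgebra C] (c : C) :
    Continuous fun χ : characterSpace ℂ C => χ c :=
  (eval_continuous c).comp continuous_induced_dom

/-- Continuity is clear at algebraic tensors. These are dense, and `*`-homomorphisms are
contractive, so the approximation is uniform in `χ`. Continuity in one variable is all that the
semigroup argument requires. -/
theorem continuous_prodChar_left {A B : Type u} [CStarAlgebra A] [CStarAlgebra B]
    (ψ : B →⋆ₐ[ℂ] ℂ) (x : MinTensor A B) :
    Continuous fun χ : characterSpace ℂ A => prodChar (charEquiv A χ) ψ x := by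
  have halg : ∀ y : A ⊗[ℂ] B, Continuous fun χ : characterSpace ℂ A =>
      tensorChar (charEquiv A χ) ψ y := fun y => by
    induction y using TensorProduct.induction_on with
    | zero => simpa using continuous_const
    | tmul a b =>
      change Continuous fun χ : characterSpace ℂ A => χ a * ψ b
      exact (continuous_eval_character a).mul continuous_const
    | add y z hy hz => simp only [map_add]; exact hy.add hz
  refine continuous_of_uniform_approx_of_continuous fun u hu => ?_
  obtain ⟨ε, hε, hu⟩ := Metric.mem_uniformity_dist.mp hu
  obtain ⟨y, hy⟩ := (minSeminorm A B).denseRange_toCompl.exists_dist_lt x hε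
  refine ⟨_, halg y, fun χ => hu ?_⟩
  rw [← prodChar_toCompl, dist_eq_norm, ← map_sub]
  exact (NonUnitalStarAlgHom.norm_apply_le _ _).trans_lt (by rwa [← dist_eq_norm])

end CharacterSpace

/-! ### The convolution semigroup of characters of a compact quantum group. -/

theorem starAlgHom_eq_of_eqOn_dense_span {D : Type*} [CStarAlgebra D] {s : Set D}
    {f g : D →⋆ₐ[ℂ] ℂ}
    (hs : Dense (Submodule.span ℂ s : Set D)) (h : ∀ x ∈ s, f x = g x) : f = g := by
  apply DFunLike.coe_injective
  refine Continuous.ext_on hs (starAlgHom_continuous f) (starAlgHom_continuous g) ?_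
  exact LinearMap.eqOn_span (f := f.toAlgHom.toLinearMap) (g := g.toAlgHom.toLinearMap)
    fun x hx => h x hx

namespace CompactQuantumGroupStructure

open WeakDual

variable {C : Type u} [CStarAlgebra C]

/-- The convolution product of characters. -/
def conv (G : CompactQuantumGroupStructure C) (χ ψ : C →⋆ₐ[ℂ] ℂ) : C →⋆ₐ[ℂ] ℂ :=
  (prodChar χ ψ).comp G.comul

theorem conv_assoc (G : CompactQuantumGroupStructure C) (χ ψ ω : C →⋆ₐ[ℂ] ℂ) :
    G.conv (G.conv χ ψ) ω = G.conv χ (G.conv ψ ω) := by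
  have h := congrArg (fun F => (prodChar₃ χ ψ ω).comp F) G.coassoc
  simp only [← StarAlgHom.comp_assoc, prodChar₃_comp_mapFirst, prodChar₃_comp_mapLast] at h
  exact h

/-- The character `χ ⊗ ψ` takes the value `χ(a) (χ * ψ)(b)` at `(a ⊗ 1) Δ(b)`. By density of the
span of these elements, `χ` and the convolution `χ * ψ` determine `χ ⊗ ψ`, hence `ψ`. Right
cancellation uses `(1 ⊗ a) Δ(b)` in the same way. -/
theorem conv_left_cancel (G : CompactQuantumGroupStructure C) {χ ψ ψ' : C →⋆ₐ[ℂ] ℂ}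
    (h : G.conv χ ψ = G.conv χ ψ') : ψ = ψ' := by
  refine (prodChar_injective (χ := χ) (χ' := χ)
    (starAlgHom_eq_of_eqOn_dense_span G.dense_left ?_)).2
  rintro _ ⟨a, b, rfl⟩
  have hb : prodChar χ ψ (G.comul b) = prodChar χ ψ' (G.comul b) := congrArg (fun F => F b) h
  simp [hb]

theorem conv_right_cancel (G : CompactQuantumGroupStructure C) {χ χ' ψ : C →⋆ₐ[ℂ] ℂ}
    (h : G.conv χ ψ = G.conv χ' ψ) : χ = χ' := by
  refine (prodChar_injective (ψ := ψ) (ψ' := ψ)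
    (starAlgHom_eq_of_eqOn_dense_span G.dense_right ?_)).1
  rintro _ ⟨a, b, rfl⟩
  have hb : prodChar χ ψ (G.comul b) = prodChar χ' ψ (G.comul b) := congrArg (fun F => F b) h
  simp [hb]

/-- The characters of a compact quantum group form a semigroup under convolution. -/
abbrev characterSemigroup (G : CompactQuantumGroupStructure C) :
    Semigroup (characterSpace ℂ C) where
  mul χ ψ := (charEquiv C).symm (G.conv (charEquiv C χ) (charEquiv C ψ))
  mul_assoc χ ψ ω := congrArg (charEquiv C).symm
    (G.conv_assoc (charEquiv C χ) (charEquiv C ψ) (charEquiv C ω))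

/-- If a compact quantum group has an isolated character, it has only finitely many characters. -/
theorem finite_characterSpace (G : CompactQuantumGroupStructure C) (χ : characterSpace ℂ C)
    (hχ : IsOpen {χ}) :
    Finite (characterSpace ℂ C) := by
  let _ := G.characterSemigroup
  have : IsCancelMul (characterSpace ℂ C) :=
    { mul_left_cancel := fun χ ψ ψ' h => (charEquiv C).injective
        (G.conv_left_cancel ((charEquiv C).symm.injective h))
      mul_right_cancel := fun χ ψ ψ' h => (charEquiv C).injective
        (G.conv_right_cancel ((charEquiv C).symm.injective h)) }
  refine finite_of_compact_cancel (fun ψ => ?_) χ hχ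
  -- Weak-* continuity of right translation is tested at each `c`, where its value is that of `χ ⊗
  -- ψ` at `Δ(c)`.
  refine Continuous.subtype_mk (WeakDual.continuous_of_continuous_eval fun c => ?_) _
  exact continuous_prodChar_left (charEquiv C ψ) (G.comul c)

end CompactQuantumGroupStructure

/-! ### Unital `*`-homomorphisms on `ℂ²` as projections. -/

section MapsToTwoPoints

variable {R : Type*} [Ring R] [StarRing R] [Algebra ℂ R] [StarModule ℂ R]

/-- The unital `*`-homomorphism on `ℂ²` taking the first minimal projection to `p`. -/
def IsStarProjection.starAlgHom {p : R} (hp : IsStarProjection p) : (Fin 2 → ℂ) →⋆ₐ[ℂ] R where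
  toFun a := a 0 • p + a 1 • (1 - p)
  map_one' := by simp
  map_mul' a b := by
    have h : p * p = p := hp.isIdempotentElem
    simp only [Pi.mul_apply, mul_add, add_mul, smul_mul_smul_comm, h, mul_sub, sub_mul, mul_one,
      one_mul, sub_self, smul_zero, add_zero, zero_add, sub_zero]
  map_zero' := by simp
  map_add' a b := by simp only [Pi.add_apply]; module
  commutes' c := by
    simp only [Pi.algebraMap_apply, Algebra.algebraMap_self, RingHom.id_apply]
    rw [Algebra.algebraMap_eq_smul_one]
    module
  map_star' a := by
    simp only [Pi.star_apply, star_add, star_smul, star_sub, star_one, hp.isSelfAdjoint.star_eq]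

theorem IsStarProjection.starAlgHom_apply {p : R} (hp : IsStarProjection p) (a : Fin 2 → ℂ) :
    hp.starAlgHom a = a 0 • p + a 1 • (1 - p) := rfl

theorem isStarProjection_starAlgHom_single (Ψ : (Fin 2 → ℂ) →⋆ₐ[ℂ] R) :
    IsStarProjection (Ψ (Pi.single 0 1)) := by
  refine IsStarProjection.mk ?_ ?_
  · rw [IsIdempotentElem, ← map_mul]
    congr 1
    ext i
    fin_cases i <;> simp
  · rw [IsSelfAdjoint, ← map_star]
    congr 1
    ext i
    fin_cases i <;> simp

/-- The unit and the first minimal projection span `ℂ²`. -/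
theorem starAlgHom_finTwo_ext {S : Type*} [Ring S] [StarRing S] [Algebra ℂ S]
    {Ψ Ψ' : (Fin 2 → ℂ) →⋆ₐ[ℂ] S}
    (h : Ψ (Pi.single 0 1) = Ψ' (Pi.single 0 1)) : Ψ = Ψ' := by
  ext a
  have ha : a = (a 0 - a 1) • Pi.single 0 1 + a 1 • 1 := by
    ext i
    fin_cases i <;> simp
  rw [ha]
  simp only [map_add, map_smul, map_one, h]

end MapsToTwoPoints

/-! ### Slice maps and the classical points of a quantum space of maps. -/

section Slice

variable {B C : Type*} [Ring B] [StarRing B] [Algebra ℂ B] [StarModule ℂ B]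
  [Ring C] [StarRing C] [Algebra ℂ C] [StarModule ℂ C]

/-- The slice map `id ⊗ χ` of a character `χ`. -/
def slice (B : Type*) [Ring B] [StarRing B] [Algebra ℂ B] [StarModule ℂ B] (χ : C →⋆ₐ[ℂ] ℂ) :
    B ⊗[ℂ] C →⋆ₐ[ℂ] B :=
  starTensorLift (StarAlgHom.id ℂ B) ((StarAlgHom.ofId ℂ B).comp χ)
    fun b c => (Algebra.commutes (χ c) b).symm

theorem slice_tmul (χ : C →⋆ₐ[ℂ] ℂ) (b : B) (c : C) :
    slice B χ (b ⊗ₜ c) = χ c • b := by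
  change b * algebraMap ℂ B (χ c) = _
  rw [← Algebra.commutes, Algebra.smul_def]

theorem slice_map {D : Type*} [Ring D] [StarRing D] [Algebra ℂ D] [StarModule ℂ D]
    (χ : D →⋆ₐ[ℂ] ℂ) (Λ : C →⋆ₐ[ℂ] D) (x : B ⊗[ℂ] C) :
    slice B χ (Algebra.TensorProduct.map (AlgHom.id ℂ B) (Λ : C →ₐ[ℂ] D) x) =
      slice B (χ.comp Λ) x := by
  induction x using TensorProduct.induction_on with
  | zero => simp
  | tmul b c =>
    rw [Algebra.TensorProduct.map_tmul, slice_tmul, slice_tmul]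
    rfl
  | add x y hx hy => simp only [map_add, hx, hy]

/-- This lets a character, viewed as a scalar-valued map to `D`, compete in the universal property,
which gives uniqueness in `IsQuantumSpaceOfMaps.existsUnique_character`. -/
theorem map_ofId_comp (D : Type*) [Ring D] [StarRing D] [Algebra ℂ D] [StarModule ℂ D]
    (χ : C →⋆ₐ[ℂ] ℂ) (x : B ⊗[ℂ] C) :
    Algebra.TensorProduct.map (AlgHom.id ℂ B)
      (((StarAlgHom.ofId ℂ D).comp χ : C →⋆ₐ[ℂ] D) : C →ₐ[ℂ] D) x = slice B χ x ⊗ₜ 1 := by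
  induction x using TensorProduct.induction_on with
  | zero => simp
  | tmul b c =>
    rw [Algebra.TensorProduct.map_tmul, slice_tmul]
    change b ⊗ₜ algebraMap ℂ D (χ c) = _
    rw [Algebra.algebraMap_eq_smul_one, TensorProduct.smul_tmul]
  | add x y hx hy => simp only [map_add, hx, hy, TensorProduct.add_tmul]

end Slice

/-- The universal property of a quantum space of maps, for characters. -/
theorem IsQuantumSpaceOfMaps.existsUnique_character {A B : Type*} {C : Type u} [Ring A] [StarRing A]
    [Algebra ℂ A] [Ring B] [StarRing B] [Algebra ℂ B] [StarModule ℂ B] [FiniteDimensional ℂ B]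
    [CStarAlgebra C] {Φ : A →⋆ₐ[ℂ] B ⊗[ℂ] C} (hΦ : IsQuantumSpaceOfMaps Φ) (Ψ : A →⋆ₐ[ℂ] B) :
    ∃! χ : C →⋆ₐ[ℂ] ℂ, (slice B χ).comp Φ = Ψ := by
  -- A copy of `ℂ` in universe `u`, since the universal property only tests algebras there.
  let D : Type u := PUnit.{u + 1} → ℂ
  let ι : ℂ →⋆ₐ[ℂ] D := StarAlgHom.ofId ℂ D
  let ev : D →⋆ₐ[ℂ] ℂ := { Pi.evalAlgHom ℂ (fun _ => ℂ) PUnit.unit with map_star' := fun _ => rfl }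
  obtain ⟨Λ, hΛ, huniq⟩ := hΦ D ((starInclLeft B D).comp Ψ)
  refine ⟨ev.comp Λ, ?_, fun χ hχ => ?_⟩
  · ext a
    have h := congrArg (slice B ev) (hΛ a)
    rw [slice_map] at h
    refine h.trans ?_
    change slice B ev (Ψ a ⊗ₜ 1) = Ψ a
    rw [slice_tmul, map_one, one_smul]
  · rw [← huniq (ι.comp χ) fun a => ?_]
    · rfl
    · rw [map_ofId_comp, ← hχ]
      rfl

open WeakDual in
theorem continuous_slice_character {B C : Type*} [Ring B] [StarRing B] [Algebra ℂ B]
    [StarModule ℂ B] [TopologicalSpace B] [ContinuousAdd B] [ContinuousSMul ℂ B] [CStarAlgebra C]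
    (x : B ⊗[ℂ] C) : Continuous fun χ : characterSpace ℂ C => slice B (charEquiv C χ) x := by
  induction x using TensorProduct.induction_on with
  | zero => simpa using continuous_const
  | tmul b c =>
    simp only [slice_tmul]
    exact (continuous_eval_character c).smul continuous_const
  | add x y hx hy => simp only [map_add]; exact hx.add hy

/-! ### Projections in matrix algebras. -/

section MatrixProjections

open Matrix

/-- The projection of `ℂ²` onto the line spanned by `(1, t)`. -/
def lineProjection (t : ℝ) : Matrix (Fin 2) (Fin 2) ℂ :=
  ((1 + t ^ 2 : ℝ) : ℂ)⁻¹ • !![1, (t : ℂ); (t : ℂ), (t : ℂ) ^ 2]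

theorem isStarProjection_lineProjection (t : ℝ) : IsStarProjection (lineProjection t) := by
  have h : ((1 + t ^ 2 : ℝ) : ℂ) ≠ 0 := by exact_mod_cast (by positivity : (1 + t ^ 2 : ℝ) ≠ 0)
  push_cast at h
  refine IsStarProjection.mk ?_ ?_
  · ext i j
    fin_cases i <;> fin_cases j <;> simp [lineProjection, Matrix.mul_apply] <;> field_simp
  · rw [IsSelfAdjoint]
    ext i j
    fin_cases i <;> fin_cases j <;> simp [lineProjection, Matrix.star_apply]

theorem lineProjection_injective : Function.Injective lineProjection := by
  intro s t hst
  have hs : ((1 + s ^ 2 : ℝ) : ℂ) ≠ 0 := by exact_mod_cast (by positivity : (1 + s ^ 2 : ℝ) ≠ 0)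
  have h0 := congrFun (congrFun hst 0) 0
  have h1 := congrFun (congrFun hst 0) 1
  simp only [lineProjection, Matrix.smul_apply, of_apply, cons_val', cons_val_zero, cons_val_one,
    smul_eq_mul, mul_one, cons_val_fin_one] at h0 h1
  rw [← h0] at h1
  -- The entries `1 / (1 + t²)` and `t / (1 + t²)` of the first row determine `t`.
  exact_mod_cast mul_left_cancel₀ (inv_ne_zero hs) h1

open scoped Matrix.Norms.L2Operator in
/-- The zero projection is isolated. -/
theorem exists_isOpen_forall_isStarProjection_mem_iff (n : Type*) [Fintype n] [DecidableEq n] :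
    ∃ U : Set (Matrix n n ℂ), IsOpen U ∧ ∀ p, IsStarProjection p → (p ∈ U ↔ p = 0) := by
  refine ⟨Metric.ball 0 1, Metric.isOpen_ball, fun p hp => ⟨fun h => ?_, ?_⟩⟩
  · rw [mem_ball_zero_iff] at h
    by_contra h0
    -- Idempotence and submultiplicativity force a nonzero projection to have norm at least `1`,
    -- hence to lie outside the open unit ball.
    have h1 : ‖p‖ ≤ ‖p‖ * ‖p‖ := by
      simpa only [hp.isIdempotentElem.eq] using norm_mul_le p p
    have h2 : 0 < ‖p‖ := norm_pos_iff.mpr h0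
    nlinarith
  · rintro rfl
    simp

end MatrixProjections

end

/-! ### The contradiction between isolated and infinitely many characters. -/

theorem theorem5p1 (C : Type u) [CStarAlgebra C]
    (Φ : (Fin 2 → ℂ) →⋆ₐ[ℂ] Matrix (Fin 2) (Fin 2) ℂ ⊗[ℂ] C)
    (hΦ : IsQuantumSpaceOfMaps Φ) :
    IsEmpty (CompactQuantumGroupStructure C) := by
  refine ⟨fun G => ?_⟩
  let M := Matrix (Fin 2) (Fin 2) ℂ
  let P : WeakDual.characterSpace ℂ C → M := fun χ => slice M (charEquiv C χ) (Φ (Pi.single 0 1))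
  have hP : Continuous P := continuous_slice_character _
  have hproj : ∀ χ, IsStarProjection (P χ) := fun χ =>
    isStarProjection_starAlgHom_single ((slice M (charEquiv C χ)).comp Φ)
  -- Equal projections give equal homomorphisms on `ℂ²`, and each of these comes from only one
  -- character.
  have hinj : Function.Injective P := fun χ ψ h => by
    refine (charEquiv C).injective ?_
    exact (hΦ.existsUnique_character ((slice M (charEquiv C ψ)).comp Φ)).unique
      (starAlgHom_finTwo_ext h) rfl
  have hsurj : ∀ p : M, IsStarProjection p → ∃ χ, P χ = p := fun p hp => by
    obtain ⟨χ, hχ, -⟩ := hΦ.existsUnique_character hp.starAlgHom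
    refine ⟨(charEquiv C).symm χ, (congrArg (fun F => F (Pi.single 0 1)) hχ).trans ?_⟩
    simp [hp.starAlgHom_apply]
  obtain ⟨χ₀, hχ₀⟩ := hsurj 0 (IsStarProjection.zero _)
  have hopen : IsOpen {χ₀} := by
    obtain ⟨U, hU, hU0⟩ := exists_isOpen_forall_isStarProjection_mem_iff (Fin 2)
    -- Every value of `P` is a projection, and `U` contains no projection except `0`; injectivity
    -- then leaves only `χ₀`.
    have h : {χ₀} = P ⁻¹' U := by
      ext χ
      rw [Set.mem_preimage, hU0 _ (hproj χ), ← hχ₀, hinj.eq_iff, Set.mem_singleton_iff]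
    exact h ▸ hU.preimage hP
  have := G.finite_characterSpace χ₀ hopen
  -- The lines of real slope already give infinitely many rank-one projections, hence infinitely
  -- many characters.
  choose f hf using fun t : ℝ => hsurj _ (isStarProjection_lineProjection t)
  have hf_inj : Function.Injective f := fun s t h =>
    lineProjection_injective (by rw [← hf s, ← hf t, h])
  exact not_injective_infinite_finite f hf_inj
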